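/- Let $N\ge 2$ and consider $N$ agents with positions $r_k(t)\in\mathbb C$ and heading angles $\theta_k(t)\in\mathbb R/2\pi\mathbb Z$ satisfying $$\dot r_k=e^{i\theta_k},\qquad \dot\theta_k=-K_k\,\frac{\partial U}{\partial\theta_k}(\theta),\qquad k=1,\dots,N,$$ where $U(\theta)=\frac N2|p_\theta|^2$ and $p_\theta=\frac1N\sum_{k=1}^N e^{i\theta_k}$. A phase arrangement $\theta\in(\mathbb R/2\pi\mathbb Z)^N$ is balanced if $p_\theta=0$ (equivalently, the centroid of the agents is instantaneously at rest). Suppose that at most $\lfloor N/2\rfloor$ of the gains $K_1,\dots,K_N$ are zero and that all the others are positive. Then solutions exist on $[0,\infty)$ for all initial positions and headings, and balanced formation is asymptotically stable, in the following sense. (i) The set $B=\{\theta: p_\theta=0\}$ is Lyapunov stable in $(\mathbb R/2\pi\mathbb Z)^N$. (ii) The agents with zero gain keep their initial headings. Fix these headings arbitrarily, and let $S\subseteq(\mathbb R/2\pi\mathbb Z)^N$ be the invariant set of phase arrangements with these headings of the zero-gain agents (so $S$ is the whole torus if no gain is zero). Then $B\cap S$ is nonempty and asymptotically stable for the dynamics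 on $S$: it is Lyapunov stable, and there is $\delta>0$ such that every solution whose initial phase arrangement lies in $S$ at distance less than $\delta$ from $B\cap S$ converges to $B\cap S$ as $t\to\infty$. (iii) For every solution, the phase arrangement converges, as $t\to\infty$, to the set of equilibria of the heading dynamics, that is, to the set of $\theta$ with $K_k\,\partial U/\partial\theta_k(\theta)=0$ for all $k$. (iv) Every equilibrium $\theta^*$ of the heading dynamics with $p_{\theta^*}\ne 0$ is unstable in the sense of Lyapunov, even under perturbations that change only the headings of agents with positive gain. -/

import Mathlib

open Filter Topology Set

noncomputable section

namespace PhaseBalancing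

/-- The `N`-torus of heading angles, with the (sup) product of the arc-length metrics on the
circle `ℝ / 2πℤ`. -/
abbrev Torus (N : ℕ) : Type := Fin N → Real.Angle

/-- The point of the torus represented by a vector of real heading angles. -/
def toTorus {N : ℕ} (θ : Fin N → ℝ) : Torus N := fun k => (θ k : Real.Angle)

/-- The phase order parameter `p_θ = (1/N) ∑ₖ e^{iθₖ}`. -/
def phaseOrder {N : ℕ} (x : Torus N) : ℂ :=
  (1 / (N : ℂ)) * ∑ k, ((x k).toCircle : ℂ)

/-- The potential `U(θ) = (N/2) |p_θ|²`. -/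
def potential {N : ℕ} (θ : Fin N → ℝ) : ℝ :=
  (N : ℝ) / 2 * ‖phaseOrder (toTorus θ)‖ ^ 2

/-- The partial derivative `∂U/∂θₖ` at `θ`. -/
def potentialPartial {N : ℕ} (θ : Fin N → ℝ) (k : Fin N) : ℝ :=
  deriv (fun s : ℝ => potential (Function.update θ k s)) (θ k)

/-- The control law `uₖ = -Kₖ ∂U/∂θₖ`. -/
def control {N : ℕ} (K : Fin N → ℝ) (θ : Fin N → ℝ) (k : Fin N) : ℝ :=
  -(K k) * potentialPartial θ k

/-- `(r, θ)` is a solution on `[0, ∞)` of the closed-loop system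
`ṙₖ = e^{iθₖ}`, `θ̇ₖ = uₖ`; the heading angles are followed continuously in `ℝ`. -/
structure IsSolution {N : ℕ} (K : Fin N → ℝ) (r : ℝ → Fin N → ℂ) (θ : ℝ → Fin N → ℝ) : Prop where
  position : ∀ t : ℝ, 0 ≤ t → ∀ k : Fin N,
    HasDerivWithinAt (fun s => r s k) (Complex.exp (Complex.I * (θ t k : ℂ))) (Ici 0) t
  heading : ∀ t : ℝ, 0 ≤ t → ∀ k : Fin N,
    HasDerivWithinAt (fun s => θ s k) (control K (θ t) k) (Ici 0) t

/-- The balanced phase arrangements `p_θ = 0`. -/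
def balancedSet (N : ℕ) : Set (Torus N) := {x | phaseOrder x = 0}

/-- The equilibria of the heading dynamics. -/
def equilibria {N : ℕ} (K : Fin N → ℝ) : Set (Torus N) :=
  {x | ∃ θ : Fin N → ℝ, toTorus θ = x ∧ ∀ k, control K θ k = 0}

/-- The phase arrangements in which every agent with zero gain has the same heading as in `c`.
Agents with zero gain never turn, so this set is invariant; it is the whole torus if no gain
is zero. -/
def slice {N : ℕ} (K : Fin N → ℝ) (c : Torus N) : Set (Torus N) :=
  {x | ∀ k, K k = 0 → x k = c k}

/-- Lyapunov stability of the set `A` for solutions whose initial headings lie in `S`. -/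
def IsStableOn {N : ℕ} (K : Fin N → ℝ) (S A : Set (Torus N)) : Prop :=
  ∀ ε : ℝ, 0 < ε → ∃ δ : ℝ, 0 < δ ∧
    ∀ (r : ℝ → Fin N → ℂ) (θ : ℝ → Fin N → ℝ), IsSolution K r θ →
      toTorus (θ 0) ∈ S → Metric.infDist (toTorus (θ 0)) A < δ →
        ∀ t : ℝ, 0 ≤ t → Metric.infDist (toTorus (θ t)) A < ε

/-- Local attractivity of the set `A` for solutions whose initial headings lie in `S`. -/
def IsAttractiveOn {N : ℕ} (K : Fin N → ℝ) (S A : Set (Torus N)) : Prop :=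
  ∃ δ : ℝ, 0 < δ ∧
    ∀ (r : ℝ → Fin N → ℂ) (θ : ℝ → Fin N → ℝ), IsSolution K r θ →
      toTorus (θ 0) ∈ S → Metric.infDist (toTorus (θ 0)) A < δ →
        Tendsto (fun t : ℝ => Metric.infDist (toTorus (θ t)) A) atTop (𝓝 0)

/-- Asymptotic stability of a nonempty set `A`: Lyapunov stability and local attractivity. -/
def IsAsymptoticallyStableOn {N : ℕ} (K : Fin N → ℝ) (S A : Set (Torus N)) : Prop :=
  A.Nonempty ∧ IsStableOn K S A ∧ IsAttractiveOn K S A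

end PhaseBalancing

end

open scoped NNReal ComplexConjugate

/-! Along solutions the potential decreases at the rate `dissipation`, whose zeros are exactly the
equilibria. Headings move with bounded speed on a compact torus, so this rate is uniformly
continuous in time and Barbalat's lemma sends it to zero; compactness turns this into convergence to
the equilibria. Monotonicity of the potential together with compactness already makes its zero set,
the balanced arrangements, Lyapunov stable.

Attraction and instability rest on a gap between levels. Write `P = expSum x`. At an equilibrium
with `P ≠ 0` every turning agent points along `P` or `-P`, so `‖P‖` is an integer in `[-N, N]` plus
or minus the modulus of the frozen agents' sum: finitely many values per slice
(`finite_norm_expSum_equilibria`). A closed set containing a forward orbit contains an equilibrium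
(`IsSolution.exists_mem_equilibria`). Hence an orbit starting below the lowest positive level must
sink to balance, and an orbit starting slightly below the level of an unbalanced equilibrium cannot
stay near it.

It remains to find balanced points in each slice and, arbitrarily near an unbalanced equilibrium,
points with smaller `‖P‖` (`exists_norm_expSum_lt`). Both use that the frozen agents do not
outnumber the turning ones: the turning unit vectors can then cancel the frozen sum, and some
turning agent is aligned with `P`, so that moving it, alone or with a partner, shortens `P`. -/

/-! ### Global integral curves -/

/-- A bounded Lipschitz vector field on a Banach space has global integral curves. -/
theorem exists_forall_hasDerivAt_of_lipschitzWith_of_norm_le {E : Type*} [NormedAddCommGroup E]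
    [NormedSpace ℝ E] [CompleteSpace E] {v : E → E} {C L : ℝ≥0} (hv : LipschitzWith C v)
    (hL : ∀ x, ‖v x‖ ≤ L) (x₀ : E) :
    ∃ α : ℝ → E, α 0 = x₀ ∧ ∀ t, HasDerivAt α (v (α t)) t := by
  have hloc (n : ℕ) : ∃ α : ℝ → E, α 0 = x₀ ∧
      ∀ t ∈ Icc (-(n + 1 : ℝ)) (n + 1),
        HasDerivWithinAt α (v (α t)) (Icc (-(n + 1 : ℝ)) (n + 1)) t := by
    have h0 : (0 : ℝ) ∈ Icc (-(n + 1 : ℝ)) (n + 1) := ⟨by linarith [n.cast_nonneg (α := ℝ)],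
      by positivity⟩
    -- The field is bounded by `L`, so in time `n + 1` the curve stays in the ball of radius `L * (n
    -- + 1)`; the local theorem thus applies on arbitrarily long intervals.
    have hpl : IsPicardLindelof (fun _ => v) (⟨0, h0⟩ : Icc (-(n + 1 : ℝ)) (n + 1)) x₀
        (L * (n + 1)) 0 L C :=
      { lipschitzOnWith := fun _ _ => hv.lipschitzOnWith
        continuousOn := fun _ _ => continuousOn_const
        norm_le := fun _ _ x _ => hL x
        mul_max_le := by simp }
    exact hpl.exists_eq_forall_mem_Icc_hasDerivWithinAt₀
  choose α hα0 hα using hloc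
  have hda (n : ℕ) (t : ℝ) (ht : t ∈ Ioo (-(n + 1 : ℝ)) (n + 1)) :
      HasDerivAt (α n) (v (α n t)) t :=
    (hα n t (Ioo_subset_Icc_self ht)).hasDerivAt (Icc_mem_nhds ht.1 ht.2)
  have hagree (m n : ℕ) (hmn : m ≤ n) : EqOn (α m) (α n) (Icc (-(m + 1 : ℝ)) (m + 1)) := by
    have hc : (m : ℝ) ≤ n := by exact_mod_cast hmn
    have hm : (0 : ℝ) ≤ m := m.cast_nonneg
    have hsub : Icc (-(m + 1 : ℝ)) (m + 1) ⊆ Icc (-(n + 1 : ℝ)) (n + 1) :=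
      Icc_subset_Icc (by linarith) (by linarith)
    refine ODE_solution_unique_of_mem_Icc (v := fun _ => v) (s := fun _ => univ) (K := C)
      (t₀ := 0) (fun _ _ => hv.lipschitzOnWith) ⟨by linarith, by linarith⟩
      (fun t ht => (hα m t ht).continuousWithinAt) (hda m) (fun _ _ => mem_univ _)
      (fun t ht => ((hα n t (hsub ht)).mono hsub).continuousWithinAt)
      (fun t ht => hda n t ⟨by linarith [ht.1], by linarith [ht.2]⟩) (fun _ _ => mem_univ _) ?_
    rw [hα0, hα0]
  -- The local curves agree on common intervals. Near `t` all the indices `⌈|s|⌉₊` are at most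
  -- `⌈|t|⌉₊ + 1`, so the glued curve coincides there with a single `α n`.
  refine ⟨fun t => α ⌈|t|⌉₊ t, by simp [hα0], fun t => ?_⟩
  set n := ⌈|t|⌉₊ + 1 with hn
  have hlt : |t| < n := by
    have := Nat.le_ceil |t|
    rw [hn]; push_cast; linarith
  have hnear : (fun s : ℝ => α ⌈|s|⌉₊ s) =ᶠ[𝓝 t] α n := by
    have : ∀ᶠ s in 𝓝 t, |s| < (n : ℝ) := continuous_abs.continuousAt.eventually (gt_mem_nhds hlt)
    filter_upwards [this] with s hs
    have h1 : ⌈|s|⌉₊ ≤ n := Nat.ceil_le.2 hs.le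
    refine hagree _ _ h1 ?_
    have := abs_le.1 (Nat.le_ceil |s|)
    exact ⟨by linarith, by linarith⟩
  have ht : t ∈ Ioo (-(n + 1 : ℝ)) (n + 1) := by
    have := abs_lt.1 hlt
    exact ⟨by linarith, by linarith⟩
  have h := (hda n t ht).congr_of_eventuallyEq hnear
  rwa [← hnear.eq_of_nhds] at h

/-! ### The potential, its gradient and the closed-loop field -/

noncomputable section

namespace PhaseBalancing

variable {N : ℕ}

/-- The sum `N p_θ` of the unit velocities. -/
def expSum (x : Torus N) : ℂ := ∑ k, ((x k).toCircle : ℂ)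

/-- The partial derivative `∂U/∂θₖ` as a function on the torus. -/
def torque (x : Torus N) (k : Fin N) : ℝ :=
  (expSum x * conj ((x k).toCircle : ℂ)).im / N

theorem phaseOrder_eq (x : Torus N) : phaseOrder x = 1 / (N : ℂ) * expSum x := rfl

theorem mem_balancedSet_iff (hN : N ≠ 0) {x : Torus N} : x ∈ balancedSet N ↔ expSum x = 0 := by
  simp [balancedSet, phaseOrder_eq, hN]

theorem continuous_angle_toCircle : Continuous Real.Angle.toCircle :=
  continuous_coinduced_dom.mpr Circle.exp.continuous

theorem continuous_expSum : Continuous (expSum : Torus N → ℂ) := by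
  unfold expSum
  exact continuous_finsetSum _ fun k _ =>
    continuous_subtype_val.comp (continuous_angle_toCircle.comp (continuous_apply k))

theorem continuous_torque (k : Fin N) : Continuous (fun x : Torus N => torque x k) := by
  unfold torque
  exact (Complex.continuous_im.comp (continuous_expSum.mul (Complex.continuous_conj.comp
    (continuous_subtype_val.comp (continuous_angle_toCircle.comp (continuous_apply k)))))).div_const _

theorem potential_eq (θ : Fin N → ℝ) :
    potential θ = ‖expSum (toTorus θ)‖ ^ 2 / (2 * N) := by
  rcases eq_or_ne N 0 with rfl | hN
  · simp [potential]
  · have : (N : ℝ) ≠ 0 := by exact_mod_cast hN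
    rw [potential, phaseOrder_eq, norm_mul, norm_div, norm_one, Complex.norm_natCast]
    field_simp

theorem potential_nonneg (θ : Fin N → ℝ) : 0 ≤ potential θ := by
  unfold potential; positivity

theorem toCircle_toTorus (θ : Fin N → ℝ) (k : Fin N) :
    ((toTorus θ k).toCircle : ℂ) = Complex.exp (θ k * Complex.I) := by
  simp [toTorus]

theorem torque_toTorus (θ : Fin N → ℝ) (k : Fin N) :
    torque (toTorus θ) k = (∑ j, Real.sin (θ j - θ k)) / N := by
  unfold torque expSum
  rw [Finset.sum_mul, Complex.im_sum]
  congr 1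
  refine Finset.sum_congr rfl fun j _ => ?_
  rw [toCircle_toTorus, toCircle_toTorus, ← Complex.exp_conj, ← Complex.exp_add]
  have : (θ j : ℂ) * Complex.I + conj ((θ k : ℂ) * Complex.I)
      = ((θ j - θ k : ℝ) : ℂ) * Complex.I := by
    simp; ring
  rw [this, Complex.exp_ofReal_mul_I_im]

/-- The chain rule for the potential along a curve of heading angles. -/
theorem hasDerivWithinAt_potential {θ : ℝ → Fin N → ℝ} {θ' : Fin N → ℝ} {s : Set ℝ} {t : ℝ}
    (h : ∀ k, HasDerivWithinAt (fun τ => θ τ k) (θ' k) s t) :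
    HasDerivWithinAt (fun τ => potential (θ τ)) (∑ k, torque (toTorus (θ t)) k * θ' k) s t := by
  have h1 : HasDerivWithinAt (fun τ => expSum (toTorus (θ τ)))
      (∑ k, Complex.exp (θ t k * Complex.I) * (θ' k * Complex.I)) s t := by
    simp only [expSum, toCircle_toTorus]
    exact HasDerivWithinAt.fun_sum fun k _ => (((h k).ofReal_comp).mul_const _).cexp
  have h2 := (h1.norm_sq).div_const (2 * (N : ℝ))
  simp only [← potential_eq] at h2
  refine h2.congr_deriv ?_
  rw [Complex.inner, Finset.sum_mul, Complex.re_sum, Finset.mul_sum, Finset.sum_div]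
  refine Finset.sum_congr rfl fun k _ => ?_
  rw [torque, toCircle_toTorus]
  simp only [Complex.mul_im, Complex.mul_re, Complex.conj_re, Complex.conj_im, Complex.ofReal_re,
    Complex.ofReal_im, Complex.I_re, Complex.I_im]
  rcases eq_or_ne (N : ℝ) 0 with hN | hN
  · simp [hN]
  · field_simp
    ring

theorem potentialPartial_eq (θ : Fin N → ℝ) (k : Fin N) :
    potentialPartial θ k = torque (toTorus θ) k := by
  have h : ∀ j, HasDerivWithinAt (fun s : ℝ => Function.update θ k s j)
      (if j = k then 1 else 0) univ (θ k) := by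
    intro j
    by_cases hj : j = k
    · subst hj
      simpa [Function.update_self] using hasDerivAt_id' (θ j)
    · simpa [hj] using hasDerivWithinAt_const (θ k) univ (θ j)
  have := (hasDerivWithinAt_potential h).hasDerivAt univ_mem
  rw [potentialPartial, this.deriv]
  simp

theorem control_eq (K : Fin N → ℝ) (θ : Fin N → ℝ) (k : Fin N) :
    control K θ k = -(K k) * torque (toTorus θ) k := by
  rw [control, potentialPartial_eq]

theorem abs_torque_le (θ : Fin N → ℝ) (k : Fin N) : |torque (toTorus θ) k| ≤ 1 := by
  have hN : (0 : ℝ) < N := by exact_mod_cast k.pos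
  rw [torque_toTorus, abs_div, abs_of_pos hN, div_le_one hN]
  calc |∑ j, Real.sin (θ j - θ k)| ≤ ∑ j : Fin N, |Real.sin (θ j - θ k)| :=
        Finset.abs_sum_le_sum_abs _ _
    _ ≤ ∑ _j : Fin N, (1 : ℝ) := Finset.sum_le_sum fun j _ => Real.abs_sin_le_one _
    _ = N := by simp

theorem abs_control_le (K : Fin N → ℝ) (θ : Fin N → ℝ) (k : Fin N) :
    |control K θ k| ≤ ‖K‖ := by
  rw [control_eq, abs_mul, abs_neg]
  calc |K k| * _ ≤ |K k| * 1 := by gcongr; exact abs_torque_le θ k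
    _ ≤ ‖K‖ := by rw [mul_one]; exact norm_le_pi_norm K k

/-- Each component is `-K k` times an average of sines of heading differences. The sine is
1-Lipschitz, and a difference of two coordinates changes by at most twice the sup distance. -/
theorem lipschitzWith_control (K : Fin N → ℝ) : LipschitzWith (2 * ‖K‖₊) (control K) := by
  refine LipschitzWith.of_dist_le_mul fun θ φ => ?_
  refine (dist_pi_le_iff (by positivity)).2 fun k => ?_
  have hN : (0 : ℝ) < N := by exact_mod_cast k.pos
  have hd : ∀ j, |θ j - φ j| ≤ dist θ φ := fun j => dist_le_pi_dist θ φ j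
  rw [control_eq, control_eq, Real.dist_eq, ← mul_sub, abs_mul, abs_neg, torque_toTorus,
    torque_toTorus, ← sub_div, abs_div, abs_of_pos hN, ← Finset.sum_sub_distrib]
  have h1 : |∑ j, (Real.sin (θ j - θ k) - Real.sin (φ j - φ k))| ≤ N * (2 * dist θ φ) := by
    refine (Finset.abs_sum_le_sum_abs _ _).trans ?_
    calc _ ≤ ∑ _j : Fin N, 2 * dist θ φ := Finset.sum_le_sum fun j _ => ?_
      _ = _ := by simp
    have h2 := Real.lipschitzWith_sin.dist_le_mul (θ j - θ k) (φ j - φ k)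
    rw [Real.dist_eq, Real.dist_eq, NNReal.coe_one, one_mul] at h2
    refine h2.trans ?_
    have : θ j - θ k - (φ j - φ k) = (θ j - φ j) - (θ k - φ k) := by ring
    rw [this]
    refine (abs_sub _ _).trans ?_
    linarith [hd j, hd k]
  have h3 : |∑ j, (Real.sin (θ j - θ k) - Real.sin (φ j - φ k))| / N ≤ 2 * dist θ φ := by
    rw [div_le_iff₀ hN]; linarith
  calc |K k| * _ ≤ ‖K‖ * (2 * dist θ φ) := by
        gcongr
        exact norm_le_pi_norm K k
    _ = _ := by push_cast; ring

/-- Solutions exist for all positive times. -/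
theorem exists_isSolution (K : Fin N → ℝ) (r₀ : Fin N → ℂ) (θ₀ : Fin N → ℝ) :
    ∃ (r : ℝ → Fin N → ℂ) (θ : ℝ → Fin N → ℝ), IsSolution K r θ ∧ r 0 = r₀ ∧ θ 0 = θ₀ := by
  obtain ⟨θ, h0, hθ⟩ := exists_forall_hasDerivAt_of_lipschitzWith_of_norm_le
    (lipschitzWith_control K) (L := ‖K‖₊)
    (fun θ => (pi_norm_le_iff_of_nonneg (norm_nonneg K)).2 (abs_control_le K θ)) θ₀
  have hc : Continuous θ := continuous_iff_continuousAt.2 fun t => (hθ t).continuousAt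
  refine ⟨fun t k => r₀ k + ∫ s in (0 : ℝ)..t, Complex.exp (Complex.I * (θ s k : ℂ)), θ,
    ⟨fun t _ k => ?_, fun t _ k => ((hasDerivAt_pi.1 (hθ t)) k).hasDerivWithinAt⟩, ?_, h0⟩
  · have hck : Continuous fun s => Complex.exp (Complex.I * (θ s k : ℂ)) := by fun_prop
    exact ((hck.integral_hasStrictDerivAt 0 t).hasDerivAt.const_add _).hasDerivWithinAt
  · funext k; simp

end PhaseBalancing

end

/-! ### Compactness and Barbalat's lemma -/

/-- On the compact part of `S` at distance at least `ε` from the zeros, `|f|` attains a positive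
minimum, which serves as `η`. This converts smallness of a function into closeness to its zero set;
the next lemma is the converse, by uniform continuity. -/
theorem exists_pos_forall_infDist_zeros_lt {X : Type*} [PseudoMetricSpace X] {f : X → ℝ}
    {S : Set X} (hS : IsCompact S) (hf : Continuous f) {ε : ℝ} (hε : 0 < ε) :
    ∃ η : ℝ, 0 < η ∧ ∀ x ∈ S, |f x| < η → Metric.infDist x ({x | f x = 0} ∩ S) < ε := by
  set A := {x | f x = 0} ∩ S with hA
  have hT : IsCompact (S ∩ {x | ε ≤ Metric.infDist x A}) :=
    hS.inter_right (isClosed_le continuous_const (Metric.continuous_infDist_pt A))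
  rcases (S ∩ {x | ε ≤ Metric.infDist x A}).eq_empty_or_nonempty with he | hne
  · refine ⟨1, one_pos, fun x hx _ => ?_⟩
    by_contra! h
    exact (he ▸ (⟨hx, h⟩ : x ∈ S ∩ {x | ε ≤ Metric.infDist x A}) : x ∈ (∅ : Set X))
  · obtain ⟨y, ⟨hyS, hyε⟩, hmin⟩ := hT.exists_isMinOn hne hf.abs.continuousOn
    refine ⟨|f y|, abs_pos.2 fun h0 => ?_, fun x hx hlt => ?_⟩
    · have : Metric.infDist y A = 0 := Metric.infDist_zero_of_mem ⟨h0, hyS⟩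
      have hyε' : ε ≤ Metric.infDist y A := hyε
      linarith
    · by_contra! h
      exact absurd (hmin ⟨hx, h⟩) (not_le.2 hlt)

theorem exists_pos_forall_abs_lt_of_infDist_lt {X : Type*} [PseudoMetricSpace X] [CompactSpace X]
    {f : X → ℝ} (hf : Continuous f) {A : Set X} (hA : A.Nonempty) (h0 : ∀ x ∈ A, f x = 0) {η : ℝ}
    (hη : 0 < η) : ∃ δ : ℝ, 0 < δ ∧ ∀ x, Metric.infDist x A < δ → |f x| < η := by
  obtain ⟨δ, hδ, h⟩ := Metric.uniformContinuous_iff.1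
    (CompactSpace.uniformContinuous_of_continuous hf) η hη
  refine ⟨δ, hδ, fun x hx => ?_⟩
  obtain ⟨y, hy, hxy⟩ := (Metric.infDist_lt_iff hA).1 hx
  simpa [Real.dist_eq, h0 y hy] using h hxy

theorem antitoneOn_of_hasDerivWithinAt_neg {V g : ℝ → ℝ}
    (hV : ∀ t, 0 ≤ t → HasDerivWithinAt V (-g t) (Ici 0) t) (hg : ∀ t, 0 ≤ t → 0 ≤ g t) :
    AntitoneOn V (Ici 0) := by
  refine antitoneOn_of_hasDerivWithinAt_nonpos (f' := fun t => -g t) (convex_Ici 0)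
    (fun t ht => (hV t ht).continuousWithinAt) (fun t ht => ?_) (fun t ht => ?_)
  · exact (hV t (interior_subset ht)).mono interior_subset
  · exact neg_nonpos.2 (hg t (interior_subset ht))

/-- **Barbalat's lemma** for a Lyapunov function: a uniformly continuous dissipation rate of a
function bounded below tends to zero. -/
theorem tendsto_zero_of_hasDerivWithinAt_neg {V g : ℝ → ℝ}
    (hV : ∀ t, 0 ≤ t → HasDerivWithinAt V (-g t) (Ici 0) t) (hg : ∀ t, 0 ≤ t → 0 ≤ g t)
    (hV0 : ∀ t, 0 ≤ V t) (huc : UniformContinuousOn g (Ici 0)) : Tendsto g atTop (𝓝 0) := by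
  have hanti := antitoneOn_of_hasDerivWithinAt_neg hV hg
  -- Freezing `V` at negative times makes it monotone on the whole line, so that it converges to its
  -- infimum.
  have hW : Antitone fun t => V (max t 0) := fun s t hst =>
    hanti (mem_Ici.2 (le_max_right _ _)) (mem_Ici.2 (le_max_right _ _)) (max_le_max_right 0 hst)
  have hbdd : BddBelow (range fun t => V (max t 0)) := ⟨0, by rintro _ ⟨t, rfl⟩; exact hV0 _⟩
  have hlim := tendsto_atTop_ciInf hW hbdd
  set l := ⨅ t, V (max t 0) with hl
  rw [Metric.tendsto_nhds]
  intro ε hε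
  obtain ⟨δ, hδ, huc⟩ := Metric.uniformContinuousOn_iff.1 huc (ε / 2) (half_pos hε)
  have hpos : 0 < δ / 2 * (ε / 2) := by positivity
  filter_upwards [hlim.eventually (gt_mem_nhds (show l < l + δ / 2 * (ε / 2) by linarith)),
    eventually_ge_atTop 0] with t ht ht0
  rw [Real.dist_eq, sub_zero, abs_of_nonneg (hg t ht0)]
  -- If `g t ≥ ε`, then `g > ε / 2` throughout `[t, t + δ / 2]`, and the mean value theorem makes
  -- `V` drop by more than `δ / 2 * (ε / 2)`, below its infimum `l`.
  by_contra! hge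
  rw [max_eq_left ht0] at ht
  have hlt : t < t + δ / 2 := by linarith
  obtain ⟨c, hc, hslope⟩ := exists_hasDerivAt_eq_slope V (fun t => -g t) hlt
    (fun s hs => ((hV s (ht0.trans hs.1)).continuousWithinAt).mono
      fun u hu => ht0.trans hu.1)
    (fun s hs => (hV s (ht0.trans hs.1.le)).hasDerivAt
      (Ici_mem_nhds (ht0.trans_lt hs.1)))
  have hgc := huc c (ht0.trans hc.1.le) t ht0 (by
    rw [Real.dist_eq, abs_lt]; constructor <;> linarith [hc.1, hc.2])
  rw [Real.dist_eq, abs_lt] at hgc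
  have hle : l ≤ V (t + δ / 2) := by
    have := ciInf_le hbdd (t + δ / 2)
    rwa [max_eq_left (by linarith)] at this
  have h2 : (V (t + δ / 2) - V t) = -g c * (δ / 2) := by
    rw [hslope, add_sub_cancel_left, div_mul_cancel₀ _ (half_pos hδ).ne']
  nlinarith

/-! ### The Lyapunov function, convergence to equilibria, stability of balance -/

noncomputable section

namespace PhaseBalancing

variable {N : ℕ} {K : Fin N → ℝ} {r : ℝ → Fin N → ℂ} {θ : ℝ → Fin N → ℝ}

instance : CompactSpace Real.Angle :=
  haveI : Fact (0 < 2 * Real.pi) := ⟨Real.two_pi_pos⟩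
  inferInstanceAs (CompactSpace (AddCircle (2 * Real.pi)))

theorem lipschitzWith_toTorus : LipschitzWith 1 (toTorus : (Fin N → ℝ) → Torus N) := by
  refine LipschitzWith.of_dist_le_mul fun θ φ => ?_
  rw [NNReal.coe_one, one_mul]
  refine (dist_pi_le_iff dist_nonneg).2 fun k => ?_
  refine le_trans ?_ (dist_le_pi_dist θ φ k)
  rw [dist_eq_norm, dist_eq_norm]
  exact QuotientAddGroup.norm_mk_le_norm

theorem exists_toTorus_eq (x : Torus N) : ∃ θ : Fin N → ℝ, toTorus θ = x := by
  have h : ∀ k, ∃ a : ℝ, (a : Real.Angle) = x k := fun k =>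
    QuotientAddGroup.mk_surjective (x k)
  choose θ hθ using h
  exact ⟨θ, funext hθ⟩

/-- The rate at which the potential decreases along solutions. -/
def dissipation (K : Fin N → ℝ) (x : Torus N) : ℝ := ∑ k, K k * torque x k ^ 2

theorem continuous_dissipation (K : Fin N → ℝ) : Continuous (dissipation K) :=
  continuous_finsetSum _ fun k _ => ((continuous_torque k).pow 2).const_mul _

theorem dissipation_nonneg (hK : ∀ k, 0 ≤ K k) (x : Torus N) : 0 ≤ dissipation K x :=
  Finset.sum_nonneg fun k _ => mul_nonneg (hK k) (sq_nonneg _)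

theorem mem_equilibria_iff {x : Torus N} :
    x ∈ equilibria K ↔ ∀ k, K k = 0 ∨ torque x k = 0 := by
  constructor
  · rintro ⟨θ, rfl, h⟩ k
    simpa [control_eq] using h k
  · intro h
    obtain ⟨θ, rfl⟩ := exists_toTorus_eq x
    exact ⟨θ, rfl, fun k => by simpa [control_eq] using h k⟩

theorem equilibria_eq (hK : ∀ k, 0 ≤ K k) : equilibria K = {x | dissipation K x = 0} := by
  ext x
  rw [mem_equilibria_iff, mem_ofPred_eq, dissipation,
    Finset.sum_eq_zero_iff_of_nonneg fun k _ => mul_nonneg (hK k) (sq_nonneg _)]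
  simp

theorem IsSolution.hasDerivWithinAt_potential (h : IsSolution K r θ) {t : ℝ} (ht : 0 ≤ t) :
    HasDerivWithinAt (fun s => potential (θ s)) (-dissipation K (toTorus (θ t))) (Ici 0) t := by
  refine (PhaseBalancing.hasDerivWithinAt_potential (h.heading t ht)).congr_deriv ?_
  rw [dissipation, ← Finset.sum_neg_distrib]
  refine Finset.sum_congr rfl fun k _ => ?_
  rw [control_eq]
  ring

theorem IsSolution.norm_expSum_le (h : IsSolution K r θ) (hK : ∀ k, 0 ≤ K k) {s t : ℝ}
    (hs : 0 ≤ s) (hst : s ≤ t) : ‖expSum (toTorus (θ t))‖ ≤ ‖expSum (toTorus (θ s))‖ := by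
  have h1 := antitoneOn_of_hasDerivWithinAt_neg (fun t ht => h.hasDerivWithinAt_potential ht)
    (fun t _ => dissipation_nonneg hK _) hs (hs.trans hst) hst
  rcases Nat.eq_zero_or_pos N with rfl | hN
  · simp [expSum]
  · have : (0 : ℝ) < 2 * N := by positivity
    simp only [potential_eq] at h1
    rw [div_le_div_iff_of_pos_right this] at h1
    exact le_of_sq_le_sq h1 (norm_nonneg _)

theorem IsSolution.mem_slice (h : IsSolution K r θ) {c : Torus N}
    (h0 : toTorus (θ 0) ∈ slice K c) {t : ℝ} (ht : 0 ≤ t) : toTorus (θ t) ∈ slice K c := by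
  intro k hk
  rw [← h0 k hk]
  have hconst : θ t k = θ 0 k := by
    have hd : ∀ s ∈ Ici (0 : ℝ), HasDerivWithinAt (fun s => θ s k) 0 (Ici 0) s := fun s hs => by
      simpa [control_eq, hk] using h.heading s hs k
    have := (convex_Ici (0 : ℝ)).norm_image_sub_le_of_norm_hasDerivWithin_le (C := 0)
      hd (by simp) self_mem_Ici ht
    simpa [sub_eq_zero] using this
  simp [toTorus, hconst]

/-- The heading speed is bounded by `‖K‖`; this supplies the uniform continuity required by
Barbalat's lemma. -/
theorem IsSolution.uniformContinuousOn (h : IsSolution K r θ) :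
    UniformContinuousOn (fun t => toTorus (θ t)) (Ici 0) := by
  have hd : ∀ t ∈ Ici (0 : ℝ), HasDerivWithinAt θ (control K (θ t)) (Ici 0) t :=
    fun t ht => hasDerivWithinAt_pi.2 (h.heading t ht)
  have hlip : LipschitzOnWith ‖K‖₊ θ (Ici 0) :=
    (convex_Ici 0).lipschitzOnWith_of_nnnorm_hasDerivWithin_le hd fun t _ =>
      (pi_norm_le_iff_of_nonneg (norm_nonneg K)).2 (abs_control_le K (θ t))
  exact lipschitzWith_toTorus.uniformContinuous.comp_uniformContinuousOn hlip.uniformContinuousOn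

theorem IsSolution.tendsto_dissipation (h : IsSolution K r θ) (hK : ∀ k, 0 ≤ K k) :
    Tendsto (fun t => dissipation K (toTorus (θ t))) atTop (𝓝 0) :=
  tendsto_zero_of_hasDerivWithinAt_neg (fun _ ht => h.hasDerivWithinAt_potential ht)
    (fun _ _ => dissipation_nonneg hK _) (fun _ => potential_nonneg _)
    ((CompactSpace.uniformContinuous_of_continuous
      (continuous_dissipation K)).comp_uniformContinuousOn h.uniformContinuousOn)

/-- Every solution converges to the set of equilibria. -/
theorem IsSolution.tendsto_infDist_equilibria (h : IsSolution K r θ) (hK : ∀ k, 0 ≤ K k) :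
    Tendsto (fun t => Metric.infDist (toTorus (θ t)) (equilibria K)) atTop (𝓝 0) := by
  rw [Metric.tendsto_nhds]
  intro ε hε
  obtain ⟨η, hη, hlt⟩ := exists_pos_forall_infDist_zeros_lt isCompact_univ
    (continuous_dissipation K) hε
  filter_upwards [(Metric.tendsto_nhds.1 (h.tendsto_dissipation hK)) η hη] with t ht
  rw [Real.dist_eq, sub_zero] at ht ⊢
  have := hlt _ (mem_univ _) ht
  rwa [inter_univ, ← equilibria_eq hK, ← abs_of_nonneg Metric.infDist_nonneg] at this

theorem isClosed_slice (K : Fin N → ℝ) (c : Torus N) : IsClosed (slice K c) := by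
  simp only [slice, ofPred_forall]
  exact isClosed_iInter fun k => isClosed_iInter fun _ =>
    isClosed_eq (continuous_apply k) continuous_const

theorem balancedSet_eq (hN : N ≠ 0) : balancedSet N = {x | ‖expSum x‖ = 0} := by
  ext x
  rw [mem_balancedSet_iff hN, mem_ofPred_eq, norm_eq_zero]

/-- The balanced arrangements in a closed invariant set are Lyapunov stable. -/
theorem isStableOn_balancedSet_inter (hN : N ≠ 0) (hK : ∀ k, 0 ≤ K k) {S : Set (Torus N)}
    (hS : IsClosed S) (hne : (balancedSet N ∩ S).Nonempty)
    (hinv : ∀ (r : ℝ → Fin N → ℂ) (θ : ℝ → Fin N → ℝ), IsSolution K r θ → toTorus (θ 0) ∈ S →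
      ∀ t : ℝ, 0 ≤ t → toTorus (θ t) ∈ S) :
    IsStableOn K S (balancedSet N ∩ S) := by
  intro ε hε
  have hc : Continuous fun x : Torus N => ‖expSum x‖ := continuous_expSum.norm
  rw [balancedSet_eq hN] at hne ⊢
  obtain ⟨η, hη, hlt⟩ := exists_pos_forall_infDist_zeros_lt hS.isCompact hc hε
  obtain ⟨δ, hδ, hδη⟩ := exists_pos_forall_abs_lt_of_infDist_lt hc hne (fun x hx => hx.1) hη
  refine ⟨δ, hδ, fun r θ h h0 hd t ht => hlt _ (hinv r θ h h0 t ht) ?_⟩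
  have := hδη _ hd
  rw [abs_norm] at this ⊢
  exact (h.norm_expSum_le hK le_rfl ht).trans_lt this

end PhaseBalancing

end

/-! ### Balanced points in a slice, equilibrium levels and attraction -/

theorem Set.Finite.exists_pos_forall_le_abs_sub {F : Set ℝ} (hF : F.Finite) (r : ℝ) :
    ∃ g : ℝ, 0 < g ∧ ∀ v ∈ F, v ≠ r → g ≤ |v - r| := by
  have hmem : (F \ {r})ᶜ ∈ 𝓝 r :=
    (hF.subset sdiff_subset).isClosed.isOpen_compl.mem_nhds (by simp)
  obtain ⟨g, hg, hsub⟩ := Metric.mem_nhds_iff.1 hmem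
  refine ⟨g, hg, fun v hv hne => ?_⟩
  by_contra! h
  exact hsub (show v ∈ Metric.ball r g from h) ⟨hv, hne⟩

/-- Every complex number of modulus at most `|s|` is a sum of unit complex numbers indexed by `s`,
provided that `s` has at least two elements. -/
theorem exists_sum_toCircle_eq {ι : Type*} [DecidableEq ι] {n : ℕ} (hn : 2 ≤ n) :
    ∀ (s : Finset ι) (z : ℂ), s.card = n → ‖z‖ ≤ n →
      ∃ f : ι → Real.Angle, ∑ k ∈ s, ((f k).toCircle : ℂ) = z := by
  induction n, hn using Nat.le_induction with
  | base =>
    intro s z hs hz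
    obtain ⟨a, b, hab, rfl⟩ := Finset.card_eq_two.1 hs
    push_cast at hz
    set φ := Real.arccos (‖z‖ / 2)
    have hφ : Real.cos φ = ‖z‖ / 2 :=
      Real.cos_arccos (by linarith [norm_nonneg z]) (by linarith)
    -- Two unit vectors placed symmetrically about the direction of `z`, at angle `φ` to it, add up
    -- to length `2 cos φ = ‖z‖`.
    refine ⟨fun k => if k = a then ((z.arg + φ : ℝ) : Real.Angle) else ((z.arg - φ : ℝ) : _), ?_⟩
    rw [Finset.sum_pair hab]
    beta_reduce
    rw [if_pos rfl, if_neg hab.symm]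
    simp only [Real.Angle.toCircle_coe, Circle.coe_exp]
    have h2 : 2 * Complex.cos φ = ‖z‖ := by
      rw [← Complex.ofReal_cos, hφ]; push_cast; ring
    conv_rhs => rw [← Complex.norm_mul_exp_arg_mul_I z, ← h2, Complex.two_cos]
    rw [add_mul, ← Complex.exp_add, ← Complex.exp_add]
    congr 2 <;> push_cast <;> ring
  | succ n hn ih =>
    intro s z hs hz
    obtain ⟨a, t, ha, rfl, ht⟩ := Finset.card_eq_succ.1 hs
    -- One unit vector is spent in the direction of `z`; the remainder has modulus `|‖z‖ - 1| ≤ n`.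
    have hz' : ‖z - Complex.exp (z.arg * Complex.I)‖ ≤ n := by
      have : z - Complex.exp (z.arg * Complex.I)
          = ((‖z‖ - 1 : ℝ) : ℂ) * Complex.exp (z.arg * Complex.I) := by
        conv_lhs => enter [1]; rw [← Complex.norm_mul_exp_arg_mul_I z]
        push_cast; ring
      rw [this, norm_mul, Complex.norm_exp_ofReal_mul_I, mul_one, Complex.norm_real,
        Real.norm_eq_abs, abs_le]
      have : (2 : ℝ) ≤ n := by exact_mod_cast hn
      push_cast at hz
      constructor <;> linarith [norm_nonneg z]
    obtain ⟨f, hf⟩ := ih t _ ht hz'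
    refine ⟨Function.update f a (z.arg : Real.Angle), ?_⟩
    rw [Finset.sum_insert ha, Function.update_self, Finset.sum_congr rfl fun k hk => by
      rw [Function.update_of_ne (ne_of_mem_of_not_mem hk ha)], hf]
    simp

noncomputable section

namespace PhaseBalancing

variable {N : ℕ} {K : Fin N → ℝ} {r : ℝ → Fin N → ℂ} {θ : ℝ → Fin N → ℝ}

/-- The bound `N / 2` enters the proof only in this form: frozen agents do not outnumber turning
ones. -/
theorem card_zero_le_card_ne_zero
    (hzero : (Finset.univ.filter (fun k : Fin N => K k = 0)).card ≤ N / 2) :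
    (Finset.univ.filter (fun k : Fin N => K k = 0)).card ≤
        (Finset.univ.filter (fun k : Fin N => ¬ K k = 0)).card ∧
      (Finset.univ.filter (fun k : Fin N => K k = 0)).card +
        (Finset.univ.filter (fun k : Fin N => ¬ K k = 0)).card = N := by
  have h := Finset.card_filter_add_card_filter_not (s := (Finset.univ : Finset (Fin N)))
    (fun k => K k = 0)
  rw [Finset.card_univ, Fintype.card_fin] at h
  omega

theorem expSum_eq_add (K : Fin N → ℝ) (x : Torus N) :
    expSum x = ∑ k with K k = 0, ((x k).toCircle : ℂ) + ∑ k with ¬ K k = 0, ((x k).toCircle : ℂ) :=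
  (Finset.sum_filter_add_sum_filter_not _ _ _).symm

theorem norm_sum_toCircle_le (s : Finset (Fin N)) (x : Torus N) :
    ‖∑ k ∈ s, ((x k).toCircle : ℂ)‖ ≤ s.card :=
  (norm_sum_le_of_le s fun k _ => (Circle.norm_coe (x k).toCircle).le).trans (by simp)

/-- The headings of the zero-gain agents can always be balanced by the other agents. -/
theorem balancedSet_inter_slice_nonempty (hN : 2 ≤ N)
    (hzero : (Finset.univ.filter (fun k : Fin N => K k = 0)).card ≤ N / 2) (c : Torus N) :
    (balancedSet N ∩ slice K c).Nonempty := by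
  obtain ⟨hle, hadd⟩ := card_zero_le_card_ne_zero hzero
  set Z := Finset.univ.filter (fun k : Fin N => K k = 0) with hZ
  set J := Finset.univ.filter (fun k : Fin N => ¬ K k = 0) with hJ
  obtain ⟨f, hf⟩ : ∃ f : Fin N → Real.Angle,
      ∑ k ∈ J, ((f k).toCircle : ℂ) = -∑ k ∈ Z, ((c k).toCircle : ℂ) := by
    -- Fewer than two turning agents forces one frozen and one turning agent, since `2 ≤ N`; the
    -- turning one is then placed opposite.
    rcases Nat.lt_or_ge J.card 2 with h1 | h2
    · obtain ⟨z, hz⟩ := Finset.card_eq_one.1 (show Z.card = 1 by omega)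
      obtain ⟨j, hj⟩ := Finset.card_eq_one.1 (show J.card = 1 by omega)
      refine ⟨fun _ => c z + (Real.pi : Real.Angle), ?_⟩
      rw [hz, hj]
      simp
    · refine exists_sum_toCircle_eq h2 J _ rfl ?_
      rw [norm_neg]
      exact (norm_sum_toCircle_le Z c).trans (by exact_mod_cast hle)
  refine ⟨fun k => if K k = 0 then c k else f k, ?_, fun k hk => by simp [hk]⟩
  rw [mem_balancedSet_iff (by omega), expSum_eq_add K]
  rw [Finset.sum_congr rfl fun k hk => by rw [if_pos (Finset.mem_filter.1 hk).2],
    Finset.sum_congr (s₁ := Finset.univ.filter (fun k : Fin N => ¬ K k = 0)) rfl fun k hk => by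
      rw [if_neg (Finset.mem_filter.1 hk).2], hf]
  simp [hZ]

/-- At an equilibrium that is not balanced, the turning agents are aligned or anti-aligned with the
order parameter. -/
theorem toCircle_eq_or_neg_of_mem_equilibria {x : Torus N} (hx : x ∈ equilibria K)
    (h0 : expSum x ≠ 0) {k : Fin N} (hk : K k ≠ 0) :
    ((x k).toCircle : ℂ) = expSum x / ‖expSum x‖ ∨
      ((x k).toCircle : ℂ) = -(expSum x / ‖expSum x‖) := by
  have hN : (N : ℝ) ≠ 0 := by exact_mod_cast k.pos.ne'
  have hR : (‖expSum x‖ : ℂ) ≠ 0 := by simpa using h0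
  have ht : torque x k = 0 := ((mem_equilibria_iff.1 hx) k).resolve_left hk
  set e : ℂ := ((x k).toCircle : ℂ) with he
  have hee : conj e * e = 1 := by
    rw [mul_comm, Complex.mul_conj, he, Circle.normSq_coe]; simp
  have him : (expSum x * conj e).im = 0 := by simpa [torque, hN] using ht
  have hz : (((expSum x * conj e).re : ℝ) : ℂ) = expSum x * conj e :=
    Complex.ext (by simp) (by simp [him])
  have hnorm : |(expSum x * conj e).re| = ‖expSum x‖ := by
    rw [← Real.norm_eq_abs, ← Complex.norm_real, hz, norm_mul, Complex.norm_conj, he,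
      Circle.norm_coe, mul_one]
  have hP : expSum x = ((expSum x * conj e).re : ℝ) * e := by
    rw [hz, mul_assoc, hee, mul_one]
  rcases (abs_eq (norm_nonneg _)).1 hnorm with h | h
  · left
    rw [h] at hP
    rw [eq_div_iff hR, mul_comm]
    exact hP.symm
  · right
    rw [h] at hP
    rw [← neg_div, eq_div_iff hR, mul_comm]
    conv_rhs => rw [hP]
    push_cast; ring

theorem exists_int_sum_eq_mul {ι : Type*} (s : Finset ι) (e : ι → ℂ) (u : ℂ)
    (h : ∀ k ∈ s, e k = u ∨ e k = -u) :
    ∃ a : ℤ, a ∈ Icc (-(s.card : ℤ)) s.card ∧ ∑ k ∈ s, e k = a * u := by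
  classical
  induction s using Finset.induction_on with
  | empty => exact ⟨0, by simp⟩
  | insert j s hj ih =>
    obtain ⟨a, ⟨ha1, ha2⟩, ha⟩ := ih fun k hk => h k (Finset.mem_insert_of_mem hk)
    rw [Finset.card_insert_of_notMem hj, Finset.sum_insert hj, ha]
    push_cast
    rcases h j (Finset.mem_insert_self _ _) with hu | hu
    · exact ⟨a + 1, ⟨by linarith, by linarith⟩, by rw [hu]; push_cast; ring⟩
    · exact ⟨a - 1, ⟨by linarith, by linarith⟩, by rw [hu]; push_cast; ring⟩

theorem norm_div_norm_self {z : ℂ} (h : z ≠ 0) : ‖z / (‖z‖ : ℂ)‖ = 1 := by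
  rw [norm_div, Complex.norm_real, norm_norm, div_self (norm_ne_zero_iff.2 h)]

theorem norm_mul_div_norm_self {z : ℂ} (h : z ≠ 0) : (‖z‖ : ℂ) * (z / (‖z‖ : ℂ)) = z :=
  mul_div_cancel₀ _ (by simpa using h)

/-- The order parameter takes only finitely many moduli on the equilibria of a slice. -/
theorem finite_norm_expSum_equilibria (K : Fin N → ℝ) (c : Torus N) :
    ((fun x => ‖expSum x‖) '' (equilibria K ∩ slice K c)).Finite := by
  set C := ‖∑ k with K k = 0, ((c k).toCircle : ℂ)‖ with hC
  have hfin : ({0} ∪ ((fun a : ℤ => (a : ℝ) + C) '' Icc (-(N : ℤ)) N ∪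
      (fun a : ℤ => (a : ℝ) - C) '' Icc (-(N : ℤ)) N)).Finite :=
    (finite_singleton _).union (((finite_Icc _ _).image _).union ((finite_Icc _ _).image _))
  refine hfin.subset ?_
  rintro _ ⟨x, ⟨hx, hxc⟩, rfl⟩
  by_cases h0 : expSum x = 0
  · exact Or.inl (by simp [h0])
  right
  obtain ⟨a, ⟨ha1, ha2⟩, ha⟩ := exists_int_sum_eq_mul
    (Finset.univ.filter (fun k : Fin N => ¬ K k = 0)) (fun k => ((x k).toCircle : ℂ))
    (expSum x / ‖expSum x‖) fun k hk =>
      toCircle_eq_or_neg_of_mem_equilibria hx h0 (Finset.mem_filter.1 hk).2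
  have hcard : (Finset.univ.filter (fun k : Fin N => ¬ K k = 0)).card ≤ N :=
    (Finset.card_le_univ _).trans (by simp)
  have haN : a ∈ Icc (-(N : ℤ)) N := ⟨by omega, by omega⟩
  have hsum : ∑ k with K k = 0, ((x k).toCircle : ℂ) = ∑ k with K k = 0, ((c k).toCircle : ℂ) :=
    Finset.sum_congr rfl fun k hk => by rw [hxc k (Finset.mem_filter.1 hk).2]
  have hP := expSum_eq_add K x
  rw [ha, hsum] at hP
  -- With `u` the direction of `P`, the frozen sum is `(‖P‖ - a) u`. Its modulus `C` depends only on
  -- `c`, so `‖P‖ = a ± C`.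
  have hCu : ∑ k with K k = 0, ((c k).toCircle : ℂ)
      = ((‖expSum x‖ - a : ℝ) : ℂ) * (expSum x / ‖expSum x‖) := by
    push_cast
    rw [sub_mul, norm_mul_div_norm_self h0]
    linear_combination -hP
  rw [hCu, norm_mul, norm_div_norm_self h0, mul_one, Complex.norm_real, Real.norm_eq_abs] at hC
  rcases abs_choice (‖expSum x‖ - a) with h | h
  · exact Or.inl ⟨a, haN, by rw [hC, h]; ring⟩
  · exact Or.inr ⟨a, haN, by rw [hC, h]; ring⟩

/-- A compact set that contains a forward orbit contains an equilibrium. -/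
theorem IsSolution.exists_mem_equilibria (h : IsSolution K r θ) (hK : ∀ k, 0 ≤ K k)
    {T : Set (Torus N)} (hT : IsClosed T) (hmem : ∀ t, 0 ≤ t → toTorus (θ t) ∈ T) :
    ∃ y ∈ T, y ∈ equilibria K := by
  -- The minimum of the dissipation over `T` lies below its values along the orbit, which tend to
  -- zero.
  obtain ⟨y, hy, hmin⟩ := hT.isCompact.exists_isMinOn ⟨_, hmem 0 le_rfl⟩
    (continuous_dissipation K).continuousOn
  refine ⟨y, hy, ?_⟩
  rw [equilibria_eq hK]
  refine le_antisymm ?_ (dissipation_nonneg hK y)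
  refine ge_of_tendsto (h.tendsto_dissipation hK) ?_
  filter_upwards [eventually_ge_atTop 0] with t ht using hmin (hmem t ht)

/-- The balanced arrangements in a slice attract the nearby solutions of the slice. -/
theorem isAttractiveOn_balancedSet_inter_slice (hN : N ≠ 0) (hK : ∀ k, 0 ≤ K k) {c : Torus N}
    (hne : (balancedSet N ∩ slice K c).Nonempty) :
    IsAttractiveOn K (slice K c) (balancedSet N ∩ slice K c) := by
  have hc : Continuous fun x : Torus N => ‖expSum x‖ := continuous_expSum.norm
  rw [balancedSet_eq hN] at hne ⊢
  obtain ⟨g, hg, hgap⟩ := (finite_norm_expSum_equilibria K c).exists_pos_forall_le_abs_sub 0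
  obtain ⟨δ, hδ, hδg⟩ := exists_pos_forall_abs_lt_of_infDist_lt hc hne (fun x hx => hx.1) hg
  refine ⟨δ, hδ, fun r θ h h0 hd => ?_⟩
  have hlt := hδg _ hd
  rw [abs_norm] at hlt
  have hslice := fun t (ht : 0 ≤ t) => h.mem_slice h0 ht
  rw [Metric.tendsto_nhds]
  intro ε hε
  obtain ⟨η, hη, hηε⟩ := exists_pos_forall_infDist_zeros_lt (isClosed_slice K c).isCompact hc hε
  obtain ⟨t₀, ht₀, hsmall⟩ : ∃ t₀, 0 ≤ t₀ ∧ ‖expSum (toTorus (θ t₀))‖ < η := by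
    -- Otherwise the orbit stays in the closed region `η ≤ ‖P‖ ≤ ‖P(0)‖` of the slice, which must
    -- then contain an equilibrium; but `‖P(0)‖ < g` excludes one.
    by_contra! hbig
    obtain ⟨y, ⟨⟨hy1, hy2⟩, hy3⟩, hyE⟩ := h.exists_mem_equilibria hK
      (T := slice K c ∩ {y | ‖expSum y‖ ≤ ‖expSum (toTorus (θ 0))‖} ∩ {y | η ≤ ‖expSum y‖})
      (((isClosed_slice K c).inter (isClosed_le hc continuous_const)).inter
        (isClosed_le continuous_const hc))
      fun t ht => ⟨⟨hslice t ht, h.norm_expSum_le hK le_rfl ht⟩, hbig t ht⟩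
    have hy2' : ‖expSum y‖ ≤ ‖expSum (toTorus (θ 0))‖ := hy2
    have hy3' : η ≤ ‖expSum y‖ := hy3
    have := hgap _ ⟨y, ⟨hyE, hy1⟩, rfl⟩ (by simpa using (hη.trans_le hy3').ne')
    rw [sub_zero, abs_norm] at this
    linarith
  filter_upwards [eventually_ge_atTop t₀] with t ht
  rw [Real.dist_eq, sub_zero, abs_of_nonneg Metric.infDist_nonneg]
  refine hηε _ (hslice t (ht₀.trans ht)) ?_
  rw [abs_norm]
  exact (h.norm_expSum_le hK ht₀ ht).trans_lt hsmall

end PhaseBalancing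

end

/-! ### Descent at unbalanced equilibria and instability -/

theorem norm_mul_ofReal_add_lt {u w : ℂ} {R : ℝ} (hu : ‖u‖ = 1) (hR : 0 ≤ R)
    (h : (R + w.re) ^ 2 + w.im ^ 2 < R ^ 2) : ‖u * (R + w)‖ < R := by
  rw [norm_mul, hu, one_mul]
  refine lt_of_pow_lt_pow_left₀ 2 hR ?_
  rw [Complex.sq_norm, Complex.normSq_apply]
  simp only [Complex.add_re, Complex.add_im, Complex.ofReal_re, Complex.ofReal_im]
  linarith

noncomputable section

namespace PhaseBalancing

variable {N : ℕ} {K : Fin N → ℝ}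

/-- Turning the single agent `a` by the angle `s`. -/
def turn (x : Torus N) (a : Fin N) (s : ℝ) : Torus N := Function.update x a (x a + s)

theorem turn_apply_self (x : Torus N) (a : Fin N) (s : ℝ) : turn x a s a = x a + s :=
  Function.update_self ..

theorem turn_apply_of_ne (x : Torus N) {a k : Fin N} (h : k ≠ a) (s : ℝ) : turn x a s k = x k :=
  Function.update_of_ne h ..

theorem dist_turn_le (x : Torus N) (a : Fin N) (s : ℝ) : dist (turn x a s) x ≤ |s| := by
  refine (dist_pi_le_iff (abs_nonneg s)).2 fun k => ?_
  rcases eq_or_ne k a with rfl | h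
  · rw [turn_apply_self, dist_eq_norm, add_sub_cancel_left]
    exact QuotientAddGroup.norm_mk_le_norm
  · rw [turn_apply_of_ne x h, dist_self]
    exact abs_nonneg s

theorem turn_mem_slice {x c : Torus N} (hx : x ∈ slice K c) {a : Fin N} (ha : K a ≠ 0) (s : ℝ) :
    turn x a s ∈ slice K c := fun k hk => by
  rw [turn_apply_of_ne x (by rintro rfl; exact ha hk), hx k hk]

theorem expSum_turn (x : Torus N) (a : Fin N) (s : ℝ) :
    expSum (turn x a s)
      = expSum x + ((x a).toCircle : ℂ) * (Complex.exp (s * Complex.I) - 1) := by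
  have h : ∑ k, (((turn x a s k).toCircle : ℂ) - ((x k).toCircle : ℂ))
      = ((turn x a s a).toCircle : ℂ) - ((x a).toCircle : ℂ) :=
    Finset.sum_eq_single a (fun k _ hk => by rw [turn_apply_of_ne x hk, sub_self]) (by simp)
  rw [Finset.sum_sub_distrib, turn_apply_self, Real.Angle.toCircle_add, Circle.coe_mul,
    Real.Angle.toCircle_coe, Circle.coe_exp] at h
  unfold expSum
  linear_combination h

/-- The new squared modulus is `R² - 2 (R - 1) (1 - cos s)`. -/
theorem norm_expSum_turn_lt_of_one_lt {x : Torus N} {a : Fin N} {R : ℝ} {u : ℂ} (hu : ‖u‖ = 1)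
    (hP : expSum x = R * u) (ha : ((x a).toCircle : ℂ) = u) (hR : 1 < R) {s : ℝ} (hs : 0 < s)
    (hs1 : s ≤ 1) : ‖expSum (turn x a s)‖ < R := by
  have hcos : Real.cos s < 1 := by
    rw [← Real.cos_zero]
    exact Real.cos_lt_cos_of_nonneg_of_le_pi le_rfl (by linarith [Real.pi_gt_three]) hs
  have : expSum (turn x a s) = u * (R + (Complex.exp (s * Complex.I) - 1)) := by
    rw [expSum_turn, hP, ha]; ring
  rw [this]
  refine norm_mul_ofReal_add_lt hu (by linarith) ?_
  simp only [Complex.sub_re, Complex.sub_im, Complex.one_re, Complex.one_im,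
    Complex.exp_ofReal_mul_I_re, Complex.exp_ofReal_mul_I_im]
  nlinarith [Real.sin_sq_add_cos_sq s, mul_pos (sub_pos.2 hR) (sub_pos.2 hcos)]

/-- Opposite turns cancel the transverse components, leaving the real factor `R - (2 - 2 cos s)`;
here `2 - 2 cos s ≤ s² ≤ R`, so the factor does not overshoot to `-R`. -/
theorem norm_expSum_turn_turn_lt_of_aligned {x : Torus N} {a b : Fin N} {R : ℝ} {u : ℂ}
    (hab : a ≠ b) (hu : ‖u‖ = 1) (hP : expSum x = R * u) (ha : ((x a).toCircle : ℂ) = u)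
    (hb : ((x b).toCircle : ℂ) = u) {s : ℝ} (hs : 0 < s) (hs1 : s ≤ 1) (hsR : s ≤ R) :
    ‖expSum (turn (turn x a s) b (-s))‖ < R := by
  have hcos : Real.cos s < 1 := by
    rw [← Real.cos_zero]
    exact Real.cos_lt_cos_of_nonneg_of_le_pi le_rfl (by linarith [Real.pi_gt_three]) hs
  have hcos' := Real.one_sub_sq_div_two_le_cos (x := s)
  have : expSum (turn (turn x a s) b (-s)) = u * (R + ((Complex.exp (s * Complex.I) - 1) +
      (Complex.exp ((-s : ℝ) * Complex.I) - 1))) := by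
    rw [expSum_turn, expSum_turn, turn_apply_of_ne x hab.symm, hP, ha, hb]; ring
  rw [this]
  refine norm_mul_ofReal_add_lt hu (by linarith) ?_
  simp only [Complex.add_re, Complex.add_im, Complex.sub_re, Complex.sub_im, Complex.one_re,
    Complex.one_im, Complex.exp_ofReal_mul_I_re, Complex.exp_ofReal_mul_I_im, Real.cos_neg,
    Real.sin_neg]
  have h1 : 0 < 2 - 2 * Real.cos s := by linarith
  have h2 : 2 - 2 * Real.cos s < 2 * R := by nlinarith
  nlinarith [mul_pos h1 (sub_pos.2 h2)]

/-- Rotating the antipodal pair rigidly by `m` leaves the sum unchanged but takes the pair off the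
axis of `P`. Opening it by `d` then adds `2 i sin d e^{im}` relative to that axis, and the squared
modulus becomes `R² - 4 sin d (R sin m - sin d)`. -/
theorem norm_expSum_turn_turn_lt_of_antialigned {x : Torus N} {a b : Fin N} {R : ℝ} {u : ℂ}
    (hab : a ≠ b) (hu : ‖u‖ = 1) (hP : expSum x = R * u) (ha : ((x a).toCircle : ℂ) = u)
    (hb : ((x b).toCircle : ℂ) = -u) (hR : 0 < R) {m d : ℝ} (hd : 0 < Real.sin d)
    (hdm : Real.sin d < R * Real.sin m) :
    ‖expSum (turn (turn x a (m + d)) b (m - d))‖ < R := by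
  have : expSum (turn (turn x a (m + d)) b (m - d))
      = u * (R + (Complex.exp ((m + d : ℝ) * Complex.I) - Complex.exp ((m - d : ℝ) * Complex.I))) := by
    rw [expSum_turn, expSum_turn, turn_apply_of_ne x hab.symm, hP, ha, hb]; ring
  rw [this]
  refine norm_mul_ofReal_add_lt hu hR.le ?_
  simp only [Complex.sub_re, Complex.sub_im, Complex.exp_ofReal_mul_I_re,
    Complex.exp_ofReal_mul_I_im, Real.cos_add, Real.cos_sub, Real.sin_add, Real.sin_sub]
  have h : (R - 2 * (Real.sin m * Real.sin d)) ^ 2 + (2 * (Real.cos m * Real.sin d)) ^ 2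
      = R ^ 2 - 4 * (Real.sin d * (R * Real.sin m - Real.sin d)) := by
    linear_combination 4 * Real.sin d ^ 2 * Real.sin_sq_add_cos_sq m
  have h2 := mul_pos hd (sub_pos.2 hdm)
  calc _ = (R - 2 * (Real.sin m * Real.sin d)) ^ 2 + (2 * (Real.cos m * Real.sin d)) ^ 2 := by ring
    _ < R ^ 2 := by rw [h]; linarith

/-- At an equilibrium that is not balanced, some turning agent is aligned with the order
parameter. -/
theorem exists_toCircle_eq_of_mem_equilibria
    (hzero : (Finset.univ.filter (fun k : Fin N => K k = 0)).card ≤ N / 2) {x : Torus N}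
    (hx : x ∈ equilibria K) (h0 : expSum x ≠ 0) :
    ∃ a, K a ≠ 0 ∧ ((x a).toCircle : ℂ) = expSum x / ‖expSum x‖ := by
  by_contra! hcon
  have hneg : ∀ k, K k ≠ 0 → ((x k).toCircle : ℂ) = -(expSum x / ‖expSum x‖) := fun k hk =>
    (toCircle_eq_or_neg_of_mem_equilibria hx h0 hk).resolve_left (hcon k hk)
  obtain ⟨hle, -⟩ := card_zero_le_card_ne_zero hzero
  have hP := expSum_eq_add K x
  rw [Finset.sum_congr (s₁ := Finset.univ.filter (fun k : Fin N => ¬ K k = 0)) rfl fun k hk =>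
    hneg k (Finset.mem_filter.1 hk).2, Finset.sum_const, nsmul_eq_mul] at hP
  -- If all turning agents opposed `P`, the frozen sum would have length `‖P‖` plus the number of
  -- turning agents, more than the frozen agents can supply.
  have hsum : ∑ k with K k = 0, ((x k).toCircle : ℂ)
      = ((‖expSum x‖ + (Finset.univ.filter (fun k : Fin N => ¬ K k = 0)).card : ℝ) : ℂ)
        * (expSum x / ‖expSum x‖) := by
    push_cast
    rw [add_mul, norm_mul_div_norm_self h0]
    linear_combination -hP
  have hnorm := norm_sum_toCircle_le (Finset.univ.filter (fun k : Fin N => K k = 0)) x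
  rw [hsum, norm_mul, norm_div_norm_self h0, mul_one, Complex.norm_real, Real.norm_eq_abs,
    abs_of_nonneg (add_nonneg (norm_nonneg _) (Nat.cast_nonneg _))] at hnorm
  have hle' : ((Finset.univ.filter (fun k : Fin N => K k = 0)).card : ℝ) ≤
    (Finset.univ.filter (fun k : Fin N => ¬ K k = 0)).card := by exact_mod_cast hle
  linarith [norm_pos_iff.2 h0]

/-- If only one agent turns, an equilibrium that is not balanced has `|∑ₖ e^{iθₖ}| = 2`. -/
theorem norm_expSum_eq_two (hN : 2 ≤ N)
    (hzero : (Finset.univ.filter (fun k : Fin N => K k = 0)).card ≤ N / 2) {x : Torus N}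
    (h0 : expSum x ≠ 0) {a : Fin N} (ha : ((x a).toCircle : ℂ) = expSum x / ‖expSum x‖)
    (huniq : ∀ b, K b ≠ 0 → b = a) (hKa : K a ≠ 0) : ‖expSum x‖ = 2 := by
  obtain ⟨hle, hadd⟩ := card_zero_le_card_ne_zero hzero
  have hJ : Finset.univ.filter (fun k : Fin N => ¬ K k = 0) = {a} := by
    ext b
    simp only [Finset.mem_filter, Finset.mem_univ, true_and, Finset.mem_singleton]
    exact ⟨huniq b, fun h => h ▸ hKa⟩
  have hP := expSum_eq_add K x
  rw [hJ, Finset.card_singleton] at hle hadd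
  obtain ⟨z, hz⟩ := Finset.card_eq_one.1
    (show (Finset.univ.filter (fun k : Fin N => K k = 0)).card = 1 by omega)
  rw [hJ, hz, Finset.sum_singleton, Finset.sum_singleton, ha] at hP
  have hz' : ((x z).toCircle : ℂ) = ((‖expSum x‖ - 1 : ℝ) : ℂ) * (expSum x / ‖expSum x‖) := by
    push_cast
    rw [sub_mul, norm_mul_div_norm_self h0]
    linear_combination -hP
  have hnorm := congrArg norm hz'
  rw [Circle.norm_coe, norm_mul, norm_div_norm_self h0, mul_one, Complex.norm_real,
    Real.norm_eq_abs] at hnorm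
  have hpos := norm_pos_iff.2 h0
  rcases abs_choice (‖expSum x‖ - 1) with h | h <;> linarith

/-- An equilibrium that is not balanced is not a local minimum of the potential on its slice. -/
theorem exists_norm_expSum_lt (hN : 2 ≤ N)
    (hzero : (Finset.univ.filter (fun k : Fin N => K k = 0)).card ≤ N / 2) {x : Torus N}
    (hx : x ∈ equilibria K) (h0 : expSum x ≠ 0) {δ : ℝ} (hδ : 0 < δ) :
    ∃ y ∈ slice K x, dist y x < δ ∧ ‖expSum y‖ < ‖expSum x‖ := by
  obtain ⟨a, hKa, ha⟩ := exists_toCircle_eq_of_mem_equilibria hzero hx h0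
  have hR := norm_pos_iff.2 h0
  have hu := norm_div_norm_self h0
  have hP := (norm_mul_div_norm_self h0).symm
  have hxs : x ∈ slice K x := fun _ _ => rfl
  set R := ‖expSum x‖
  -- A lone turning agent has `R = 2 > 1` and can descend by itself; otherwise a second turning
  -- agent, aligned or anti-aligned, is moved together with `a`.
  by_cases huniq : ∀ b, K b ≠ 0 → b = a
  · have hs : 0 < min (δ / 2) 1 := by positivity
    have hs1 : min (δ / 2) 1 ≤ δ / 2 := min_le_left _ _
    refine ⟨turn x a (min (δ / 2) 1), turn_mem_slice hxs hKa _, ?_,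
      norm_expSum_turn_lt_of_one_lt hu hP ha
        (by rw [show R = 2 from norm_expSum_eq_two hN hzero h0 ha huniq hKa]; norm_num) hs
        (min_le_right _ _)⟩
    refine (dist_turn_le x a _).trans_lt ?_
    rw [abs_of_pos hs]
    linarith
  · push Not at huniq
    obtain ⟨b, hKb, hba⟩ := huniq
    have hdist : ∀ s t : ℝ, |s| + |t| < δ → dist (turn (turn x a s) b t) x < δ := fun s t h =>
      (dist_triangle _ (turn x a s) _).trans_lt
        (by linarith [dist_turn_le (turn x a s) b t, dist_turn_le x a s])
    rcases toCircle_eq_or_neg_of_mem_equilibria hx h0 hKb with hb | hb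
    · set s := min (δ / 4) (min 1 R) with hs
      have hs0 : 0 < s := by positivity
      have hs1 : s ≤ δ / 4 := min_le_left _ _
      refine ⟨_, turn_mem_slice (turn_mem_slice hxs hKa s) hKb (-s), hdist _ _ ?_,
        norm_expSum_turn_turn_lt_of_aligned hba.symm hu hP ha hb hs0
          ((min_le_right _ _).trans (min_le_left _ _))
          ((min_le_right _ _).trans (min_le_right _ _))⟩
      rw [abs_neg, abs_of_pos hs0]
      linarith
    · set m := min (δ / 8) 1 with hm
      have hm0 : 0 < m := by positivity
      have hm1 : m ≤ δ / 8 := min_le_left _ _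
      have hm2 : m ≤ 1 := min_le_right _ _
      have hsin : 0 < Real.sin m :=
        Real.sin_pos_of_pos_of_lt_pi hm0 (by linarith [Real.pi_gt_three])
      -- The second bound gives `sin d < d < R sin m`; the first keeps `m - d` nonnegative, so the
      -- two turns total `2 m < δ`.
      set d := min m (R * Real.sin m / 2) with hd
      have hRs : 0 < R * Real.sin m := mul_pos hR hsin
      have hd0 : 0 < d := lt_min hm0 (half_pos hRs)
      have hd1 : d ≤ m := min_le_left _ _
      have hd2 : d ≤ R * Real.sin m / 2 := min_le_right _ _
      refine ⟨_, turn_mem_slice (turn_mem_slice hxs hKa (m + d)) hKb (m - d), hdist _ _ ?_,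
        norm_expSum_turn_turn_lt_of_antialigned hba.symm hu hP ha hb hR
          (Real.sin_pos_of_pos_of_lt_pi hd0 (by linarith [Real.pi_gt_three]))
          ((Real.sin_lt hd0).trans (by linarith))⟩
      rw [abs_of_nonneg (by linarith : 0 ≤ m + d), abs_of_nonneg (by linarith : 0 ≤ m - d)]
      linarith

/-- An equilibrium that is not balanced is unstable within its slice. -/
theorem not_isStableOn_singleton (hN : 2 ≤ N) (hK : ∀ k, 0 ≤ K k)
    (hzero : (Finset.univ.filter (fun k : Fin N => K k = 0)).card ≤ N / 2) {x : Torus N}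
    (hx : x ∈ equilibria K) (h0 : expSum x ≠ 0) : ¬ IsStableOn K (slice K x) {x} := by
  intro hstable
  have hc : Continuous fun x : Torus N => ‖expSum x‖ := continuous_expSum.norm
  obtain ⟨g, hg, hgap⟩ :=
    (finite_norm_expSum_equilibria K x).exists_pos_forall_le_abs_sub ‖expSum x‖
  obtain ⟨ε, hε, hnear⟩ := Metric.continuousAt_iff.1 (hc.continuousAt (x := x)) g hg
  obtain ⟨δ, hδ, hstay⟩ := hstable (ε / 2) (half_pos hε)
  obtain ⟨y, hys, hyx, hlt⟩ := exists_norm_expSum_lt hN hzero hx h0 hδ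
  obtain ⟨θ₀, rfl⟩ := exists_toTorus_eq y
  obtain ⟨r, θ, hsol, -, rfl⟩ := exists_isSolution K 0 θ₀
  have hclose := hstay r θ hsol hys (by rwa [Metric.infDist_singleton])
  -- An orbit that starts at a lower level and stays near `x` yields an equilibrium `z` near `x`
  -- with `‖expSum z‖ < ‖expSum x‖`. The gap puts the two levels at least `g` apart, while
  -- continuity puts them closer than `g`.
  obtain ⟨z, ⟨⟨hz1, hz2⟩, hz3⟩, hzE⟩ := hsol.exists_mem_equilibria hK
    (T := slice K x ∩ {z | ‖expSum z‖ ≤ ‖expSum (toTorus (θ 0))‖} ∩ Metric.closedBall x (ε / 2))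
    (((isClosed_slice K x).inter (isClosed_le hc continuous_const)).inter
      Metric.isClosed_closedBall)
    fun t ht => ⟨⟨hsol.mem_slice hys ht, hsol.norm_expSum_le hK le_rfl ht⟩, by
      have := hclose t ht
      rw [Metric.infDist_singleton] at this
      exact this.le⟩
  have hz2' : ‖expSum z‖ ≤ ‖expSum (toTorus (θ 0))‖ := hz2
  have h1 := hgap _ ⟨z, ⟨hzE, hz1⟩, rfl⟩ (hz2'.trans_lt hlt).ne
  have h2 := hnear (show dist z x < ε from (Metric.mem_closedBall.1 hz3).trans_lt (by linarith))
  rw [Real.dist_eq] at h2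
  exact absurd h1 (not_le.2 h2)

end PhaseBalancing

end

theorem mainTheorem12 (N : ℕ) (hN : 2 ≤ N) (K : Fin N → ℝ)
    (hpos : ∀ k, K k = 0 ∨ 0 < K k)
    (hzero : (Finset.univ.filter (fun k : Fin N => K k = 0)).card ≤ N / 2) :
    -- solutions exist for all positive times, from all initial positions and headings
    (∀ (r₀ : Fin N → ℂ) (θ₀ : Fin N → ℝ), ∃ (r : ℝ → Fin N → ℂ) (θ : ℝ → Fin N → ℝ),
        PhaseBalancing.IsSolution K r θ ∧ r 0 = r₀ ∧ θ 0 = θ₀) ∧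
    -- the balanced set is Lyapunov stable on the whole torus
    PhaseBalancing.IsStableOn K Set.univ (PhaseBalancing.balancedSet N) ∧
    -- balanced formation is asymptotically stable, whatever the headings of the zero-gain agents
    (∀ c : PhaseBalancing.Torus N,
        PhaseBalancing.IsAsymptoticallyStableOn K (PhaseBalancing.slice K c)
          (PhaseBalancing.balancedSet N ∩ PhaseBalancing.slice K c)) ∧
    -- every solution converges to the set of equilibria
    (∀ (r : ℝ → Fin N → ℂ) (θ : ℝ → Fin N → ℝ), PhaseBalancing.IsSolution K r θ →
        Filter.Tendsto
          (fun t : ℝ => Metric.infDist (PhaseBalancing.toTorus (θ t)) (PhaseBalancing.equilibria K))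
          Filter.atTop (nhds 0)) ∧
    -- every equilibrium that is not balanced is unstable
    (∀ x ∈ PhaseBalancing.equilibria K, x ∉ PhaseBalancing.balancedSet N →
        ¬ PhaseBalancing.IsStableOn K (PhaseBalancing.slice K x) {x}) := by
  have hN0 : N ≠ 0 := by omega
  have hK : ∀ k, 0 ≤ K k := fun k => (hpos k).elim (fun h => h.ge) fun h => h.le
  have hne := fun c => PhaseBalancing.balancedSet_inter_slice_nonempty hN hzero c
  refine ⟨PhaseBalancing.exists_isSolution K, ?_, fun c => ⟨hne c, ?_, ?_⟩,
    fun r θ h => h.tendsto_infDist_equilibria hK, fun x hx hxB => ?_⟩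
  · have := PhaseBalancing.isStableOn_balancedSet_inter hN0 hK isClosed_univ
      (by rw [inter_univ]; exact (hne 0).mono inter_subset_left) fun _ _ _ _ _ _ => mem_univ _
    rwa [inter_univ] at this
  · exact PhaseBalancing.isStableOn_balancedSet_inter hN0 hK
      (PhaseBalancing.isClosed_slice K c) (hne c) fun _ _ h h0 _ ht => h.mem_slice h0 ht
  · exact PhaseBalancing.isAttractiveOn_balancedSet_inter_slice hN0 hK (hne c)
  · exact PhaseBalancing.not_isStableOn_singleton hN hK hzero hx
      (mt (PhaseBalancing.mem_balancedSet_iff hN0).2 hxB)
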